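/- For real random variables $A,B$ on a probability space write $A\le_{\rm st}B$ if $\mathbb P(A\le x)\ge\mathbb P(B\le x)$ for all $x\in\mathbb R$. A random variable is *super-Pareto* if it has the same distribution as $f(Y)$, where $\mathbb P(Y\le y)=1-1/y$ for $y\ge 1$ and $f:[1,\infty)\to\mathbb R$ is non-decreasing, convex and non-constant. Random variables $X_1,\dots,X_n$ are *weakly negatively associated* if for every $i$, every Borel set $S\subseteq\mathbb R^{n-1}$ that is decreasing ($\mathbf x\in S$ and $\mathbf y\le\mathbf x$ componentwise imply $\mathbf y\in S$), and every $x\in\mathbb R$ with $\mathbb P(X_i\le x)>0$, one has $\mathbb P(\mathbf X_{-i}\in S\mid X_i\le x)\le\mathbb P(\mathbf X_{-i}\in S)$, where $\mathbf X_{-i}=(X_j)_{j\ne i}$. A sequence $X_1,X_2,\dots$ is *WNAID* if its members are identically distributed and $X_1,\dots,X_n$ are weakly negatively associated for every $n$. **Proposition.** Let $X_1,X_2,\dots$ be WNAID super-Pareto random variables, let $X$ have the same distribution as $X_1$, let $W_1,W_2,\dots$ be (almost surely) positive random variables, and let $N$ be a random variable with values in $\{0,1,2,\dots\}$. Assume that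 the four objects $X$, $(X_i)_{i\ge1}$, $(W_i)_{i\ge1}$ and $N$ are mutually independent (no independence is assumed within the sequence $(X_i)$ or within the sequence $(W_i)$). Then $$X\,\mathbf 1_{\{N\ge1\}}\ \le_{\rm st}\ \frac{\sum_{i=1}^N W_iX_i}{\sum_{i=1}^N W_i}\qquad\text{and}\qquad \sum_{i=1}^N W_i X\ \le_{\rm st}\ \sum_{i=1}^N W_iX_i ,$$ where the sums and the quotient are $0$ when $N=0$. Moreover, if $\mathbb P(N\ge2)>0$, then for every $t>z_X$, $$\mathbb P\left(\frac{\sum_{i=1}^N W_iX_i}{\sum_{i=1}^N W_i}\le t\right)<\mathbb P\left(X\,\mathbf 1_{\{N\ge1\}}\le t\right),$$ where $z_X=\inf\{z\in\mathbb R:\mathbb P(X\le z)>0\}$ is the essential infimum of $X$. -/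

import Mathlib

open MeasureTheory ProbabilityTheory

/-- First-order stochastic dominance `X ≤_st Y`: `P(X ≤ x) ≥ P(Y ≤ x)` for all real `x`. -/
def StochLE {Ω : Type*} [MeasurableSpace Ω] (μ : Measure Ω) (X Y : Ω → ℝ) : Prop :=
  ∀ x : ℝ, μ {ω | Y ω ≤ x} ≤ μ {ω | X ω ≤ x}

/-- `X` is super-Pareto: it has the distribution of `f(Y)`, where `Y` has the Pareto(1)
distribution (scale `1`, tail parameter `1`, supported on `[1, ∞)`) and `f` is increasing,
convex and non-constant on `[1, ∞)`. The values of `f` outside `[1, ∞)` are irrelevant. -/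
def IsSuperPareto {Ω : Type*} [MeasurableSpace Ω] (μ : Measure Ω) (X : Ω → ℝ) : Prop :=
  ∃ f : ℝ → ℝ, MonotoneOn f (Set.Ici 1) ∧ ConvexOn ℝ (Set.Ici 1) f ∧
    (∃ x ∈ Set.Ici (1 : ℝ), ∃ y ∈ Set.Ici (1 : ℝ), f x ≠ f y) ∧
    IdentDistrib X f μ (paretoMeasure 1 1)

/-- The random variables `X i`, `i : ι`, are weakly negatively associated:
`P(X_{-i} ∈ S | X_i ≤ x) ≤ P(X_{-i} ∈ S)` for every index `i`, every decreasing (Borel) set `S`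
of vectors indexed by the other indices, and every real `x` with `P(X_i ≤ x) > 0`. -/
def IsWeaklyNegAssoc {Ω : Type*} [MeasurableSpace Ω] {ι : Type*} (μ : Measure Ω)
    (X : ι → Ω → ℝ) : Prop :=
  ∀ (i : ι) (S : Set ({j : ι // j ≠ i} → ℝ)), IsLowerSet S → MeasurableSet S →
    ∀ x : ℝ, 0 < μ {ω | X i ω ≤ x} →
      μ[{ω | (fun j : {j : ι // j ≠ i} => X j ω) ∈ S} | {ω | X i ω ≤ x}] ≤
        μ {ω | (fun j : {j : ι // j ≠ i} => X j ω) ∈ S}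

/-- The sequence `X 0, X 1, …` is WNAID: identically distributed, with every finite initial
segment (equivalently, every finite subfamily) weakly negatively associated. -/
structure IsWNAID {Ω : Type*} [MeasurableSpace Ω] (μ : Measure Ω) (X : ℕ → Ω → ℝ) : Prop where
  weaklyNegAssoc : ∀ n : ℕ, IsWeaklyNegAssoc μ (fun (i : Fin n) => X i)
  identDistrib : ∀ i : ℕ, IdentDistrib (X i) (X 0) μ μ

/-! Write `X = f(Y)` with `Y` Pareto(1), `z = f 1` and `P(X ≤ t) = c / (c + 1)`, where `c + 1` is
the last point at which `f ≤ t`. Convexity along the chord from `1` to `u` gives `f((1 - θ) + θ u) ≤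
(1 - θ) z + θ f(u)`, hence `P(θ X + (1 - θ) z ≤ t) ≤ c / (c + θ)` (`IsSuperPareto.exists_cdf`).

Fix weights `θ i` with sum `1`. Since every `X i ≥ z`, the event `∑ θ i * X i ≤ t` forces `θ i * X i
+ (1 - θ i) * z ≤ t` for each `i`. Negative dependence bounds the probability of this intersection
by `∏ c / (c + θ i) = 1 / ∏ (1 + θ i / c)`, and `∏ (1 + θ i / c) ≥ 1 + 1 / c` brings it below `c /
(c + 1)`; two positive weights make this strict when `c > 0` (`IsWNAID.real_weighted_sum_le`).
Random weights and random `N` follow by conditioning, as they are independent of the variables. -/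

/-! ### The Pareto(1) law -/

/-- The tail function of the Pareto(1) distribution. -/
theorem paretoMeasure_one_one_Ioi {y : ℝ} (hy : 1 ≤ y) :
    paretoMeasure 1 1 (Set.Ioi y) = ENNReal.ofReal (1 / y) := by
  have hy0 : 0 < y := by linarith
  have hint : IntegrableOn (fun x : ℝ => x ^ (-2 : ℝ)) (Set.Ioi y) :=
    integrableOn_Ioi_rpow_of_lt (by norm_num) hy0
  have h : ∫⁻ x in Set.Ioi y, paretoPDF 1 1 x
      = ∫⁻ x in Set.Ioi y, ENNReal.ofReal (x ^ (-2 : ℝ)) := by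
    refine setLIntegral_congr_fun measurableSet_Ioi fun x hx => ?_
    have hx' : (1 : ℝ) ≤ x := hy.trans (le_of_lt hx)
    simp only [paretoPDF_of_le hx']
    norm_num
  rw [paretoMeasure, withDensity_apply _ measurableSet_Ioi, h,
    ← ofReal_integral_eq_lintegral_ofReal hint, integral_Ioi_rpow_of_lt (by norm_num) hy0]
  · norm_num [Real.rpow_neg_one]
  · filter_upwards [ae_restrict_mem measurableSet_Ioi] with x hx
    exact Real.rpow_nonneg (hy0.le.trans (le_of_lt hx)) _

theorem paretoMeasure_one_one_real_Iic {y : ℝ} (hy : 1 ≤ y) :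
    (paretoMeasure 1 1).real (Set.Iic y) = 1 - 1 / y := by
  have : IsProbabilityMeasure (paretoMeasure 1 1) :=
    isProbabilityMeasure_paretoMeasure one_pos one_pos
  have h := probReal_compl_eq_one_sub (μ := paretoMeasure 1 1) (measurableSet_Ioi (a := y))
  rw [Set.compl_Ioi, measureReal_def _ (Set.Ioi y), paretoMeasure_one_one_Ioi hy,
    ENNReal.toReal_ofReal (by positivity)] at h
  exact h

theorem ae_one_le_paretoMeasure_one_one : ∀ᵐ y ∂(paretoMeasure 1 1), (1 : ℝ) ≤ y := by
  have : IsProbabilityMeasure (paretoMeasure 1 1) :=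
    isProbabilityMeasure_paretoMeasure one_pos one_pos
  have h : paretoMeasure 1 1 (Set.Ioi 1)ᶜ = 0 := by
    rw [prob_compl_eq_zero_iff measurableSet_Ioi, paretoMeasure_one_one_Ioi le_rfl]
    simp
  filter_upwards [mem_ae_iff.2 h] with y hy using le_of_lt hy

/-! ### Convexity and super-Pareto distribution functions -/

/-- Slopes of a convex function do not decrease, so one strict increase forces linear growth
afterwards. This keeps the sublevel sets of `f` bounded, so that their suprema are meaningful. -/
theorem ConvexOn.unbounded_of_monotoneOn_Ici_one {f : ℝ → ℝ} (hm : MonotoneOn f (Set.Ici 1))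
    (hc : ConvexOn ℝ (Set.Ici 1) f)
    (hne : ∃ x ∈ Set.Ici (1 : ℝ), ∃ y ∈ Set.Ici (1 : ℝ), f x ≠ f y) (t : ℝ) :
    ∃ M : ℝ, 1 ≤ M ∧ t < f M := by
  have key : ∀ x ∈ Set.Ici (1 : ℝ), ∀ y ∈ Set.Ici (1 : ℝ), x < y → f x ≠ f y →
      ∃ M : ℝ, 1 ≤ M ∧ t < f M := by
    intro x hx y hy hxy hne
    have hlt : f x < f y := lt_of_le_of_ne (hm hx hy hxy.le) hne
    set s := (f y - f x) / (y - x) with hs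
    have hs0 : 0 < s := div_pos (by linarith) (by linarith)
    -- The line of slope `s` through `(y, f y)` reaches `t` at `y + (t - f y) / s`; the extra `1`
    -- makes the excess strict.
    set M := max (y + 1) (y + (t - f y) / s + 1) with hM
    have hyM : y < M := lt_of_lt_of_le (by linarith) (le_max_left _ _)
    have hM1 : 1 ≤ M := le_trans hy hyM.le
    refine ⟨M, hM1, ?_⟩
    have h := hc.slope_mono_adjacent hx (Set.mem_Ici.2 hM1) hxy hyM
    rw [le_div_iff₀ (by linarith)] at h
    have h2 : (t - f y) / s < M - y := by
      have := le_max_right (y + 1) (y + (t - f y) / s + 1)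
      rw [← hM] at this
      linarith
    rw [div_lt_iff₀ hs0] at h2
    nlinarith [h, h2]
  obtain ⟨x, hx, y, hy, hxy⟩ := hne
  rcases lt_trichotomy x y with h | h | h
  · exact key x hx y hy h hxy
  · exact absurd (by rw [h]) hxy
  · exact key y hy x hx h hxy.symm

/-- The distribution function of a super-Pareto variable with left endpoint `z`, compared with
that of its rescalings around `z`. -/
theorem IsSuperPareto.exists_cdf {Ω : Type*} [MeasurableSpace Ω] {μ : Measure Ω} {X : Ω → ℝ}
    (h : IsSuperPareto μ X) :
    ∃ z : ℝ, (∀ᵐ ω ∂μ, z ≤ X ω) ∧ ∀ t : ℝ, ∃ c : ℝ, 0 ≤ c ∧ (z < t → 0 < c) ∧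
      μ.real {ω | X ω ≤ t} = c / (c + 1) ∧
      ∀ θ : ℝ, 0 < θ → θ ≤ 1 → μ.real {ω | X ω ≤ (t - (1 - θ) * z) / θ} ≤ c / (c + θ) := by
  obtain ⟨f, hm, hc, hne, hid⟩ := h
  have : IsProbabilityMeasure (paretoMeasure 1 1) :=
    isProbabilityMeasure_paretoMeasure one_pos one_pos
  have hae := ae_one_le_paretoMeasure_one_one
  have hz : ∀ᵐ ω ∂μ, f 1 ≤ X ω := by
    refine hid.symm.ae_snd (p := fun x => f 1 ≤ x) measurableSet_Ici ?_
    filter_upwards [hae] with y hy using hm (Set.mem_Ici.2 le_rfl) hy hy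
  have hdist : ∀ s, μ.real {ω | X ω ≤ s} = (paretoMeasure 1 1).real {y | f y ≤ s} := fun s =>
    congrArg ENNReal.toReal (hid.measure_mem_eq (measurableSet_Iic (a := s)))
  have hnull : ∀ s, s < f 1 → μ.real {ω | X ω ≤ s} = 0 := by
    intro s hs
    rw [measureReal_def, measure_eq_zero_iff_ae_notMem.2, ENNReal.toReal_zero]
    filter_upwards [hz] with ω hω
    simp only [not_le]
    linarith
  refine ⟨f 1, hz, fun t => ?_⟩
  -- Below the left endpoint `c = 0` works, since the rescaled threshold stays below `f 1`.
  rcases lt_or_ge t (f 1) with ht | ht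
  · refine ⟨0, le_rfl, fun h => absurd h (not_lt.2 ht.le), by simpa using hnull t ht, ?_⟩
    intro θ hθ hθ1
    rw [hnull _ ?_]
    · simp
    · rw [div_lt_iff₀ hθ]
      linarith
  · set A : Set ℝ := {y | 1 ≤ y ∧ f y ≤ t} with hA
    obtain ⟨M, hM1, hM⟩ := ConvexOn.unbounded_of_monotoneOn_Ici_one hm hc hne t
    have hbdd : BddAbove A := ⟨M, fun y hy => by
      by_contra hcon
      have := hm (Set.mem_Ici.2 hM1) (Set.mem_Ici.2 hy.1) (not_le.1 hcon).le
      linarith [hy.2]⟩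
    have h1A : (1 : ℝ) ∈ A := ⟨le_rfl, ht⟩
    set y := sSup A with hy
    have hy1 : 1 ≤ y := le_csSup hbdd h1A
    have hgt : ∀ v, y < v → t < f v := by
      intro v hv
      by_contra hcon
      exact absurd (le_csSup hbdd (show v ∈ A from ⟨hy1.trans hv.le, not_lt.1 hcon⟩))
        (not_le.2 hv)
    have hlt : ∀ v, 1 ≤ v → v < y → f v ≤ t := by
      intro v hv1 hv
      obtain ⟨a, ha, hva⟩ := exists_lt_of_lt_csSup ⟨1, h1A⟩ hv
      exact (hm (Set.mem_Ici.2 hv1) (Set.mem_Ici.2 ha.1) hva.le).trans ha.2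
    refine ⟨y - 1, by linarith, ?_, ?_, ?_⟩
    · intro hzt
      have h2 := hm (Set.mem_Ici.2 le_rfl) (Set.mem_Ici.2 (by norm_num : (1 : ℝ) ≤ 2))
        (by norm_num)
      -- The chord over `[1, 2]` shows `f (1 + ε) ≤ t`, whence `y > 1`. The `+ 1` keeps the
      -- denominator positive when `f 2 = f 1`.
      set ε := min 1 ((t - f 1) / (f 2 - f 1 + 1)) with hε
      have hpos : 0 < f 2 - f 1 + 1 := by linarith
      have hε0 : 0 < ε := lt_min one_pos (div_pos (by linarith) hpos)
      have hε1 : ε ≤ 1 := min_le_left _ _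
      have hε2 : ε * (f 2 - f 1 + 1) ≤ t - f 1 :=
        (le_div_iff₀ hpos).1 (min_le_right _ _)
      have hcv := hc.2 (Set.mem_Ici.2 (le_refl (1 : ℝ)))
        (Set.mem_Ici.2 (by norm_num : (1 : ℝ) ≤ 2)) (sub_nonneg.2 hε1) hε0.le (by ring)
      simp only [smul_eq_mul] at hcv
      have hmem : (1 - ε) * 1 + ε * 2 ∈ A := ⟨by linarith, by nlinarith⟩
      have := le_csSup hbdd hmem
      linarith
    · rw [hdist]
      have hq : (paretoMeasure 1 1).real (Set.Iic y) = (y - 1) / (y - 1 + 1) := by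
        rw [paretoMeasure_one_one_real_Iic hy1, sub_add_cancel, sub_div, div_self (by linarith)]
      rw [← hq]
      -- The sublevel set is an interval ending at `y`; whether it contains `y` is immaterial, as
      -- the law has no atoms.
      have hvol : paretoMeasure 1 1 {y} = 0 :=
        (withDensity_absolutelyContinuous _ _) (by simp)
      refine measureReal_congr ?_
      filter_upwards [hae, measure_eq_zero_iff_ae_notMem.1 hvol] with v hv1 hv
      refine propext ⟨fun h => ?_, fun h => ?_⟩
      · by_contra hcon
        exact absurd h (not_le.2 (hgt v (not_le.1 hcon)))
      · exact hlt v hv1 (lt_of_le_of_ne h hv)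
    · intro θ hθ hθ1
      rw [hdist]
      -- `v` solves `(1 - θ) + θ v = y`, so any `u > v` would give a point beyond `y` with `f ≤ t`.
      set v := (y - 1 + θ) / θ with hv
      have hv1 : 1 ≤ v := by
        rw [hv, le_div_iff₀ hθ]
        linarith
      have hq : (paretoMeasure 1 1).real (Set.Iic v) = (y - 1) / (y - 1 + θ) := by
        have : 0 < y - 1 + θ := by linarith
        rw [paretoMeasure_one_one_real_Iic hv1, hv]
        field_simp
        ring
      rw [← hq]
      refine ENNReal.toReal_mono (measure_ne_top _ _) (measure_mono_ae ?_)
      filter_upwards [hae] with u hu1 hu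
      by_contra hcon
      have hvu : v < u := not_le.1 hcon
      rw [hv, div_lt_iff₀ hθ] at hvu
      have hcv := hc.2 (Set.mem_Ici.2 (le_refl (1 : ℝ))) (Set.mem_Ici.2 hu1)
        (sub_nonneg.2 hθ1) hθ.le (by ring)
      simp only [smul_eq_mul] at hcv
      have h3 := hgt ((1 - θ) * 1 + θ * u) (by linarith)
      have hu' : f u ≤ (t - (1 - θ) * f 1) / θ := hu
      rw [le_div_iff₀ hθ] at hu'
      linarith

/-! ### Negative dependence and deterministic weights -/

/-- Weak negative association of an initial segment implies negative lower orthant dependence. -/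
theorem IsWNAID.real_iInter_le_prod {Ω : Type*} [MeasurableSpace Ω] {μ : Measure Ω}
    [IsProbabilityMeasure μ] {X : ℕ → Ω → ℝ} (hX : ∀ i, Measurable (X i)) (h : IsWNAID μ X)
    (a : ℕ → ℝ) (n : ℕ) :
    μ.real {ω | ∀ i < n, X i ω ≤ a i} ≤ ∏ i ∈ Finset.range n, μ.real {ω | X i ω ≤ a i} := by
  induction n with
  | zero => simp
  | succ n ih =>
    rw [Finset.prod_range_succ]
    have hsplit : {ω | ∀ i < n + 1, X i ω ≤ a i}
        = {ω | X n ω ≤ a n} ∩ {ω | ∀ i < n, X i ω ≤ a i} := by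
      ext ω
      simp only [Set.mem_ofPred_eq, Set.mem_inter_iff, Nat.lt_succ_iff_lt_or_eq]
      refine ⟨fun h => ⟨h n (Or.inr rfl), fun i hi => h i (Or.inl hi)⟩, fun h i hi => ?_⟩
      rcases hi with hi | rfl
      exacts [h.2 i hi, h.1]
    rcases eq_or_ne (μ {ω | X n ω ≤ a n}) 0 with h0 | h0
    · have : μ.real {ω | X n ω ≤ a n} = 0 := by simp [measureReal_def, h0]
      rw [this, mul_zero, hsplit, measureReal_def,
        measure_mono_null Set.inter_subset_left h0, ENNReal.toReal_zero]
    -- A lower orthant in the first `n` coordinates is a decreasing set; conditioning on the last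
    -- coordinate splits off one factor.
    set S : Set ({j : Fin (n + 1) // j ≠ Fin.last n} → ℝ) := {x | ∀ j, x j ≤ a j.1} with hS
    have hSmeas : MeasurableSet S := by
      simp only [hS, Set.ofPred_forall]
      exact MeasurableSet.iInter fun j => measurableSet_le (measurable_pi_apply j) measurable_const
    have hSlow : IsLowerSet S := fun x y hyx hx j => (hyx j).trans (hx j)
    have hSet : {ω | (fun j : {j : Fin (n + 1) // j ≠ Fin.last n} => X j.1 ω) ∈ S}
        = {ω | ∀ i < n, X i ω ≤ a i} := by
      ext ω
      simp only [hS, Set.mem_ofPred_eq]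
      refine ⟨fun h i hi => h ⟨⟨i, hi.trans (Nat.lt_succ_self n)⟩, fun he => ?_⟩,
        fun h j => h _ ?_⟩
      · have := congrArg Fin.val he
        simp at this
        omega
      · exact Fin.val_lt_last j.2
    have key := h.weaklyNegAssoc (n + 1) (Fin.last n) S hSlow hSmeas (a n)
      (pos_iff_ne_zero.2 h0)
    rw [hSet] at key
    have hmeas : MeasurableSet {ω | X n ω ≤ a n} := measurableSet_le (hX n) measurable_const
    simp only [Fin.val_last] at key
    rw [cond_apply hmeas, ← hsplit, ENNReal.inv_mul_le_iff h0 (measure_ne_top _ _)] at key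
    have key' := ENNReal.toReal_mono (by finiteness) key
    rw [ENNReal.toReal_mul] at key'
    calc μ.real {ω | ∀ i < n + 1, X i ω ≤ a i}
        ≤ μ.real {ω | X n ω ≤ a n} * μ.real {ω | ∀ i < n, X i ω ≤ a i} := key'
      _ ≤ μ.real {ω | X n ω ≤ a n} * ∏ i ∈ Finset.range n, μ.real {ω | X i ω ≤ a i} := by
        gcongr
      _ = _ := mul_comm _ _

theorem one_add_sum_range_le_prod {a : ℕ → ℝ} {n : ℕ} (ha : ∀ i < n, 0 < a i) :
    1 + ∑ i ∈ Finset.range n, a i ≤ ∏ i ∈ Finset.range n, (1 + a i) := by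
  induction n with
  | zero => simp
  | succ n ih =>
    rw [Finset.sum_range_succ, Finset.prod_range_succ]
    have h1 := ih fun i hi => ha i (by omega)
    have h2 := ha n (by omega)
    have h3 : 0 ≤ ∑ i ∈ Finset.range n, a i :=
      Finset.sum_nonneg fun i hi => (ha i (by simp at hi; omega)).le
    nlinarith

/-- Two positive terms already produce a positive cross product. -/
theorem one_add_sum_range_lt_prod {a : ℕ → ℝ} {n : ℕ} (hn : 2 ≤ n) (ha : ∀ i < n, 0 < a i) :
    1 + ∑ i ∈ Finset.range n, a i < ∏ i ∈ Finset.range n, (1 + a i) := by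
  obtain ⟨n, rfl⟩ : ∃ m, n = m + 1 := ⟨n - 1, by omega⟩
  rw [Finset.sum_range_succ, Finset.prod_range_succ]
  have h1 := one_add_sum_range_le_prod (a := a) (n := n) fun i hi => ha i (by omega)
  have h2 := ha n (by omega)
  have h3 : 0 < ∑ i ∈ Finset.range n, a i :=
    Finset.sum_pos (fun i hi => ha i (by simp at hi; omega)) ⟨0, by simp; omega⟩
  nlinarith

/-- Comparison of a positively weighted sum of WNAID super-Pareto variables with one of them. -/
theorem IsWNAID.real_weighted_sum_le {Ω : Type*} [MeasurableSpace Ω] {μ : Measure Ω}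
    [IsProbabilityMeasure μ] {X : ℕ → Ω → ℝ} (hX : ∀ i, Measurable (X i)) (h : IsWNAID μ X)
    {z : ℝ} (hz : ∀ᵐ ω ∂μ, z ≤ X 0 ω) {c t : ℝ} (hc : 0 ≤ c)
    (hct : μ.real {ω | X 0 ω ≤ t} = c / (c + 1))
    (hcθ : ∀ θ : ℝ, 0 < θ → θ ≤ 1 →
      μ.real {ω | X 0 ω ≤ (t - (1 - θ) * z) / θ} ≤ c / (c + θ))
    {w : ℕ → ℝ} {n : ℕ} (hn : 1 ≤ n) (hw : ∀ i < n, 0 < w i) :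
    μ.real {ω | ∑ i ∈ Finset.range n, w i * X i ω ≤ t * ∑ i ∈ Finset.range n, w i}
        ≤ μ.real {ω | X 0 ω ≤ t} ∧
      (0 < c → 2 ≤ n →
        μ.real {ω | ∑ i ∈ Finset.range n, w i * X i ω ≤ t * ∑ i ∈ Finset.range n, w i}
          < μ.real {ω | X 0 ω ≤ t}) := by
  set s := ∑ i ∈ Finset.range n, w i with hs
  have hs0 : 0 < s :=
    Finset.sum_pos (fun i hi => hw i (Finset.mem_range.1 hi)) ⟨0, by simp; omega⟩
  set θ : ℕ → ℝ := fun i => w i / s with hθ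
  have hθ0 : ∀ i < n, 0 < θ i := fun i hi => div_pos (hw i hi) hs0
  have hθs : ∑ i ∈ Finset.range n, θ i = 1 := by
    rw [hθ, ← Finset.sum_div, ← hs, div_self hs0.ne']
  have hθ1 : ∀ i < n, θ i ≤ 1 := fun i hi => by
    rw [← hθs]
    exact Finset.single_le_sum (f := θ) (fun j hj => (hθ0 j (Finset.mem_range.1 hj)).le)
      (Finset.mem_range.2 hi)
  set a : ℕ → ℝ := fun i => (t - (1 - θ i) * z) / θ i with ha
  have hzall : ∀ᵐ ω ∂μ, ∀ i, z ≤ X i ω := ae_all_iff.2 fun i =>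
    (h.identDistrib i).symm.ae_snd (p := fun x => z ≤ x) measurableSet_Ici hz
  have hsub : μ.real {ω | ∑ i ∈ Finset.range n, w i * X i ω ≤ t * s}
      ≤ μ.real {ω | ∀ i < n, X i ω ≤ a i} := by
    refine ENNReal.toReal_mono (measure_ne_top _ _) (measure_mono_ae ?_)
    filter_upwards [hzall] with ω hω hle i hi
    have hle' : ∑ i ∈ Finset.range n, w i * X i ω ≤ t * s := hle
    -- After centring at `z` all summands are nonnegative, so one of them is at most the whole sum.
    have hnn : w i * (X i ω - z) ≤ ∑ j ∈ Finset.range n, w j * (X j ω - z) :=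
      Finset.single_le_sum (f := fun j => w j * (X j ω - z))
        (fun j hj => mul_nonneg (hw j (Finset.mem_range.1 hj)).le (sub_nonneg.2 (hω j)))
        (Finset.mem_range.2 hi)
    simp only [mul_sub, Finset.sum_sub_distrib] at hnn
    rw [← Finset.sum_mul, ← hs] at hnn
    have hwi : w i = θ i * s := by simp only [hθ]; field_simp
    show X i ω ≤ (t - (1 - θ i) * z) / θ i
    rw [le_div_iff₀ (hθ0 i hi)]
    rw [hwi] at hnn
    refine le_of_mul_le_mul_right ?_ hs0
    nlinarith
  have hprod : μ.real {ω | ∑ i ∈ Finset.range n, w i * X i ω ≤ t * s}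
      ≤ ∏ i ∈ Finset.range n, c / (c + θ i) := by
    refine (hsub.trans (h.real_iInter_le_prod hX a n)).trans ?_
    refine Finset.prod_le_prod (fun i _ => measureReal_nonneg) fun i hi => ?_
    have hi' := Finset.mem_range.1 hi
    have heq : μ.real {ω | X i ω ≤ a i} = μ.real {ω | X 0 ω ≤ a i} :=
      congrArg ENNReal.toReal
        ((h.identDistrib i).measure_mem_eq (measurableSet_Iic (a := a i)))
    rw [heq]
    exact hcθ (θ i) (hθ0 i hi') (hθ1 i hi')
  rw [hct]
  rcases hc.eq_or_lt with rfl | hc0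
  · refine ⟨hprod.trans ?_, fun h => absurd h (lt_irrefl _)⟩
    rw [Finset.prod_eq_zero (Finset.mem_range.2 (by omega : 0 < n)) (by simp)]
    simp
  · have hb : ∀ i < n, 0 < θ i / c := fun i hi => div_pos (hθ0 i hi) hc0
    have hrw : ∏ i ∈ Finset.range n, c / (c + θ i)
        = (∏ i ∈ Finset.range n, (1 + θ i / c))⁻¹ := by
      rw [← Finset.prod_inv_distrib]
      refine Finset.prod_congr rfl fun i hi => ?_
      have := hθ0 i (Finset.mem_range.1 hi)
      field_simp
    have hone : c / (c + 1) = (1 + ∑ i ∈ Finset.range n, θ i / c)⁻¹ := by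
      rw [← Finset.sum_div, hθs]
      field_simp
    have hpos : 0 < 1 + ∑ i ∈ Finset.range n, θ i / c := by
      rw [← Finset.sum_div, hθs]
      positivity
    rw [hrw] at hprod
    rw [hone]
    exact ⟨hprod.trans (inv_anti₀ hpos (one_add_sum_range_le_prod hb)), fun _ hn2 =>
      hprod.trans_lt (inv_strictAnti₀ hpos (one_add_sum_range_lt_prod hn2 hb))⟩

/-! ### Conditioning on independent variables -/

theorem ProbabilityTheory.IndepFun.measure_prodMk_mem_eq_lintegral {Ω β γ : Type*}
    [MeasurableSpace Ω] [MeasurableSpace β] [MeasurableSpace γ] {μ : Measure Ω}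
    [IsProbabilityMeasure μ] {U : Ω → β} {V : Ω → γ} (h : IndepFun U V μ) (hU : Measurable U)
    (hV : Measurable V) {S : Set (β × γ)} (hS : MeasurableSet S) :
    μ {ω | (U ω, V ω) ∈ S} = ∫⁻ ω, μ {ω' | (U ω', V ω) ∈ S} ∂μ := by
  have h1 : μ {ω | (U ω, V ω) ∈ S} = μ.map (fun ω => (U ω, V ω)) S :=
    (Measure.map_apply (hU.prodMk hV) hS).symm
  have := Measure.isProbabilityMeasure_map (μ := μ) hU.aemeasurable
  have := Measure.isProbabilityMeasure_map (μ := μ) hV.aemeasurable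
  rw [h1, (indepFun_iff_map_prod_eq_prod_map_map hU.aemeasurable hV.aemeasurable).1 h,
    Measure.prod_apply_symm hS, lintegral_map (measurable_measure_prodMk_right hS) hV]
  exact lintegral_congr fun ω => Measure.map_apply hU (measurable_prodMk_right hS)

theorem measure_eq_tsum_inter_fiber {Ω : Type*} [MeasurableSpace Ω] (μ : Measure Ω) {N : Ω → ℕ}
    (hN : Measurable N) {A : Set Ω} (hA : MeasurableSet A) :
    μ A = ∑' n, μ (A ∩ N ⁻¹' {n}) := by
  rw [← measure_iUnion]
  · congr 1
    ext ω
    simp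
  · intro m n hmn
    refine Set.disjoint_left.2 fun ω h1 h2 => hmn ?_
    exact h1.2.symm.trans h2.2
  · exact fun n => hA.inter (hN (measurableSet_singleton n))

/-- In `ℝ` the liminf defining `essInf` needs coboundedness: some event `X ≤ M` has positive
probability. -/
theorem le_essInf_of_ae_le_real {Ω : Type*} [MeasurableSpace Ω] {μ : Measure Ω}
    [IsProbabilityMeasure μ] {X : Ω → ℝ} {z : ℝ} (h : ∀ᵐ ω ∂μ, z ≤ X ω) : z ≤ essInf X μ := by
  obtain ⟨M, hM⟩ : ∃ M : ℕ, ¬ ∀ᵐ ω ∂μ, ¬ X ω ≤ M := by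
    by_contra! hcon
    obtain ⟨ω, hω⟩ := (ae_all_iff.2 hcon).exists
    obtain ⟨M, hM⟩ := exists_nat_ge (X ω)
    exact (hω M).not_ge hM
  refine Filter.le_liminf_of_le ?_ h
  exact Filter.IsCobounded.of_frequently_le (l := (M : ℝ)) (Filter.frequently_map.2 hM)

section Conditioning

variable {Ω : Type*} [MeasurableSpace Ω] {μ : Measure Ω} [IsProbabilityMeasure μ]
  {Xs W : ℕ → Ω → ℝ}

/-- Conditioning a weighted sum on the independent weights. -/
theorem measure_weighted_sum_le_eq_lintegral (hXs : ∀ i, Measurable (Xs i))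
    (hW : ∀ i, Measurable (W i))
    (hind : IndepFun (fun ω i => Xs i ω) (fun ω i => W i ω) μ) (n : ℕ) (t x : ℝ) :
    μ {ω | ∑ i ∈ Finset.range n, W i ω * Xs i ω ≤ x + t * ∑ i ∈ Finset.range n, W i ω} =
      ∫⁻ ω, μ {ω' | ∑ i ∈ Finset.range n, W i ω * Xs i ω' ≤
        x + t * ∑ i ∈ Finset.range n, W i ω} ∂μ := by
  have hS : MeasurableSet {p : (ℕ → ℝ) × (ℕ → ℝ) |
      ∑ i ∈ Finset.range n, p.2 i * p.1 i ≤ x + t * ∑ i ∈ Finset.range n, p.2 i} :=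
    measurableSet_le (by fun_prop) (by fun_prop)
  exact hind.measure_prodMk_mem_eq_lintegral (measurable_pi_iff.2 hXs) (measurable_pi_iff.2 hW) hS

theorem measure_sum_weights_mul_le_eq_lintegral {X : Ω → ℝ} (hX : Measurable X)
    (hW : ∀ i, Measurable (W i)) (hind : IndepFun X (fun ω i => W i ω) μ) (n : ℕ) (x : ℝ) :
    μ {ω | ∑ i ∈ Finset.range n, W i ω * X ω ≤ x} =
      ∫⁻ ω, μ {ω' | ∑ i ∈ Finset.range n, W i ω * X ω' ≤ x} ∂μ := by
  have hS : MeasurableSet {p : ℝ × (ℕ → ℝ) | ∑ i ∈ Finset.range n, p.2 i * p.1 ≤ x} :=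
    measurableSet_le (by fun_prop) (by fun_prop)
  exact hind.measure_prodMk_mem_eq_lintegral hX (measurable_pi_iff.2 hW) hS

end Conditioning

/-! ### Random weights and a random number of summands -/

theorem mainTheorem6 {Ω : Type*} [MeasurableSpace Ω] (μ : Measure Ω) [IsProbabilityMeasure μ]
    (X : Ω → ℝ) (Xs W : ℕ → Ω → ℝ) (N : Ω → ℕ)
    (hX : Measurable X) (hXs : ∀ i, Measurable (Xs i)) (hW : ∀ i, Measurable (W i))
    (hN : Measurable N)
    (hWNAID : IsWNAID μ Xs)
    (hsuper : ∀ i, IsSuperPareto μ (Xs i))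
    (hid : IdentDistrib X (Xs 0) μ μ)
    (hWpos : ∀ i, ∀ᵐ ω ∂μ, 0 < W i ω)
    (hindep : iIndep
      ![MeasurableSpace.comap X inferInstance,
        MeasurableSpace.comap (fun ω i => Xs i ω) inferInstance,
        MeasurableSpace.comap (fun ω i => W i ω) inferInstance,
        MeasurableSpace.comap N inferInstance] μ) :
    StochLE μ ({ω | 1 ≤ N ω}.indicator X)
      (fun ω => (∑ i ∈ Finset.range (N ω), W i ω * Xs i ω) / ∑ i ∈ Finset.range (N ω), W i ω) ∧
    StochLE μ (fun ω => ∑ i ∈ Finset.range (N ω), W i ω * X ω)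
      (fun ω => ∑ i ∈ Finset.range (N ω), W i ω * Xs i ω) ∧
    (0 < μ {ω | 2 ≤ N ω} → ∀ t : ℝ, essInf X μ < t →
      μ {ω | (∑ i ∈ Finset.range (N ω), W i ω * Xs i ω) /
          (∑ i ∈ Finset.range (N ω), W i ω) ≤ t} <
        μ {ω | {ω | 1 ≤ N ω}.indicator X ω ≤ t}) := by
  obtain ⟨z, hz, hcdf⟩ := (hsuper 0).exists_cdf
  have hWall : ∀ᵐ ω ∂μ, ∀ i, 0 < W i ω := ae_all_iff.2 hWpos
  have hXsm : Measurable (fun ω i => Xs i ω) := measurable_pi_iff.2 hXs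
  have hWm : Measurable (fun ω i => W i ω) := measurable_pi_iff.2 hW
  -- independence of the pairs that are needed
  have hle : ∀ i, ![MeasurableSpace.comap X inferInstance,
        MeasurableSpace.comap (fun ω i => Xs i ω) inferInstance,
        MeasurableSpace.comap (fun ω i => W i ω) inferInstance,
        MeasurableSpace.comap N inferInstance] i ≤ ‹MeasurableSpace Ω› := by
    intro i
    fin_cases i
    exacts [hX.comap_le, hXsm.comap_le, hWm.comap_le, hN.comap_le]
  have hXsW : IndepFun (fun ω i => Xs i ω) (fun ω i => W i ω) μ :=
    (IndepFun_iff_Indep _ _ _).2 (hindep.indep (i := 1) (j := 2) (by decide))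
  have hXW : IndepFun X (fun ω i => W i ω) μ :=
    (IndepFun_iff_Indep _ _ _).2 (hindep.indep (i := 0) (j := 2) (by decide))
  have hXN : IndepFun X N μ :=
    (IndepFun_iff_Indep _ _ _).2 (hindep.indep (i := 0) (j := 3) (by decide))
  have hXWN : IndepFun (fun ω => (X ω, fun i => W i ω)) N μ := by
    rw [IndepFun_iff_Indep]
    have h := indep_iSup_of_disjoint hle hindep (S := {0, 2}) (T := {3}) (by simp)
    refine indep_of_indep_of_le_left (indep_of_indep_of_le_right h ?_) ?_
    · exact le_iSup₂_of_le 3 (Set.mem_singleton _) le_rfl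
    · refine (MeasurableSpace.comap_prodMk _ _).trans_le ?_
      exact sup_le (le_iSup₂_of_le 0 (by simp) le_rfl) (le_iSup₂_of_le 2 (by simp) le_rfl)
  have hXsWN : IndepFun (fun ω => (fun i => Xs i ω, fun i => W i ω)) N μ := by
    rw [IndepFun_iff_Indep]
    have h := indep_iSup_of_disjoint hle hindep (S := {1, 2}) (T := {3}) (by simp)
    refine indep_of_indep_of_le_left (indep_of_indep_of_le_right h ?_) ?_
    · exact le_iSup₂_of_le 3 (Set.mem_singleton _) le_rfl
    · refine (MeasurableSpace.comap_prodMk _ _).trans_le ?_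
      exact sup_le (le_iSup₂_of_le 1 (by simp) le_rfl) (le_iSup₂_of_le 2 (by simp) le_rfl)
  -- the comparison for fixed weights and a fixed number of summands
  have hfix : ∀ t : ℝ, ∀ n, 1 ≤ n → ∀ᵐ ω ∂μ,
      μ {ω' | ∑ i ∈ Finset.range n, W i ω * Xs i ω' ≤ t * ∑ i ∈ Finset.range n, W i ω} ≤
          μ {ω | X ω ≤ t} ∧
        (z < t → 2 ≤ n →
          μ {ω' | ∑ i ∈ Finset.range n, W i ω * Xs i ω' ≤ t * ∑ i ∈ Finset.range n, W i ω} <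
            μ {ω | X ω ≤ t}) := by
    intro t n hn
    obtain ⟨c, hc, hzc, hct, hcθ⟩ := hcdf t
    have hXt : μ {ω | X ω ≤ t} = μ {ω | Xs 0 ω ≤ t} := hid.measure_mem_eq measurableSet_Iic
    filter_upwards [hWall] with ω hω
    have h := hWNAID.real_weighted_sum_le hXs hz hc hct hcθ (w := fun i => W i ω) hn
      fun i _ => hω i
    rw [hXt]
    exact ⟨(ENNReal.toReal_le_toReal (measure_ne_top _ _) (measure_ne_top _ _)).1 h.1,
      fun h1 h2 => (ENNReal.toReal_lt_toReal (measure_ne_top _ _) (measure_ne_top _ _)).1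
        (h.2 (hzc h1) h2)⟩
  have hD : ∀ t : ℝ, ∀ n,
      μ {ω | ∑ i ∈ Finset.range n, W i ω * Xs i ω ≤ t * ∑ i ∈ Finset.range n, W i ω} =
        ∫⁻ ω, μ {ω' | ∑ i ∈ Finset.range n, W i ω * Xs i ω' ≤
          t * ∑ i ∈ Finset.range n, W i ω} ∂μ := fun t n => by
    simpa using measure_weighted_sum_le_eq_lintegral hXs hW hXsW n t 0
  have hDle : ∀ t : ℝ, ∀ n, 1 ≤ n →
      μ {ω | ∑ i ∈ Finset.range n, W i ω * Xs i ω ≤ t * ∑ i ∈ Finset.range n, W i ω} ≤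
        μ {ω | X ω ≤ t} := fun t n hn => by
    rw [hD]
    calc _ ≤ ∫⁻ _, μ {ω | X ω ≤ t} ∂μ := lintegral_mono_ae ((hfix t n hn).mono fun _ h => h.1)
      _ = _ := by simp
  have hDlt : ∀ t : ℝ, z < t → ∀ n, 2 ≤ n →
      μ {ω | ∑ i ∈ Finset.range n, W i ω * Xs i ω ≤ t * ∑ i ∈ Finset.range n, W i ω} <
        μ {ω | X ω ≤ t} := fun t ht n hn => by
    have hne := measure_ne_top μ
      {ω | ∑ i ∈ Finset.range n, W i ω * Xs i ω ≤ t * ∑ i ∈ Finset.range n, W i ω}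
    rw [hD] at hne ⊢
    calc _ < ∫⁻ _, μ {ω | X ω ≤ t} ∂μ :=
          lintegral_strict_mono (IsProbabilityMeasure.ne_zero μ) aemeasurable_const hne
            ((hfix t n (by omega)).mono fun _ h => h.2 ht hn)
      _ = _ := by simp
  have hElt : ∀ x : ℝ, ∀ n, 1 ≤ n →
      μ {ω | ∑ i ∈ Finset.range n, W i ω * Xs i ω ≤ x} ≤
        μ {ω | ∑ i ∈ Finset.range n, W i ω * X ω ≤ x} := fun x n hn => by
    have hl := measure_weighted_sum_le_eq_lintegral hXs hW hXsW n 0 x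
    simp only [zero_mul, add_zero] at hl
    rw [hl, measure_sum_weights_mul_le_eq_lintegral hX hW hXW]
    refine lintegral_mono_ae ?_
    filter_upwards [hWall] with ω hω
    set s := ∑ i ∈ Finset.range n, W i ω with hs
    have hs0 : 0 < s := Finset.sum_pos (fun i _ => hω i) ⟨0, by simp; omega⟩
    -- The threshold `x / s` depends on the frozen weights, so `c` is chosen after conditioning.
    obtain ⟨c, hc, -, hct, hcθ⟩ := hcdf (x / s)
    have h := (hWNAID.real_weighted_sum_le hXs hz hc hct hcθ (w := fun i => W i ω) hn
      fun i _ => hω i).1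
    have hXt : μ {ω | X ω ≤ x / s} = μ {ω | Xs 0 ω ≤ x / s} :=
      hid.measure_mem_eq measurableSet_Iic
    have h' := (ENNReal.toReal_le_toReal (measure_ne_top _ _) (measure_ne_top _ _)).1 h
    rw [← hXt, ← hs, div_mul_cancel₀ _ hs0.ne'] at h'
    refine h'.trans_eq (congrArg μ ?_)
    ext ω'
    simp only [Set.mem_ofPred_eq, ← Finset.sum_mul, ← hs, le_div_iff₀' hs0]
  -- summation over the values of `N`
  have hsumm : ∀ {V : ℕ → Ω → ℝ}, (∀ n, Measurable (V n)) → Measurable fun ω => V (N ω) ω :=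
    fun {V} hV => (measurable_from_prod_countable_right (f := fun p : ℕ × Ω => V p.1 p.2) hV).comp
      (hN.prodMk measurable_id)
  have hQ : ∀ t : ℝ, MeasurableSet {ω | (∑ i ∈ Finset.range (N ω), W i ω * Xs i ω) /
      (∑ i ∈ Finset.range (N ω), W i ω) ≤ t} := fun t =>
    measurableSet_le (hsumm (V := fun n ω => (∑ i ∈ Finset.range n, W i ω * Xs i ω) /
      ∑ i ∈ Finset.range n, W i ω) fun n => by fun_prop) measurable_const
  have hI : ∀ t : ℝ, MeasurableSet {ω | {ω | 1 ≤ N ω}.indicator X ω ≤ t} := fun t =>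
    measurableSet_le (hX.indicator (measurableSet_le measurable_const hN)) measurable_const
  have hQfib : ∀ t : ℝ, ∀ n, 1 ≤ n → μ ({ω | (∑ i ∈ Finset.range (N ω), W i ω * Xs i ω) /
      (∑ i ∈ Finset.range (N ω), W i ω) ≤ t} ∩ N ⁻¹' {n}) =
      μ {ω | ∑ i ∈ Finset.range n, W i ω * Xs i ω ≤ t * ∑ i ∈ Finset.range n, W i ω} *
        μ (N ⁻¹' {n}) := fun t n hn => by
    have hS : MeasurableSet {p : (ℕ → ℝ) × (ℕ → ℝ) |
        ∑ i ∈ Finset.range n, p.2 i * p.1 i ≤ t * ∑ i ∈ Finset.range n, p.2 i} :=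
      measurableSet_le (by fun_prop) (by fun_prop)
    refine Eq.trans (measure_congr ?_)
      (hXsWN.measure_inter_preimage_eq_mul _ _ hS (measurableSet_singleton n))
    filter_upwards [hWall] with ω hω
    refine propext (and_congr_left fun h => ?_)
    have h' : N ω = n := h
    have hs0 : 0 < ∑ i ∈ Finset.range n, W i ω :=
      Finset.sum_pos (fun i _ => hω i) ⟨0, by simp; omega⟩
    show (∑ i ∈ Finset.range (N ω), W i ω * Xs i ω) / (∑ i ∈ Finset.range (N ω), W i ω) ≤ t ↔ _
    rw [h', div_le_iff₀ hs0]
    rfl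
  have hIfib : ∀ t : ℝ, ∀ n, 1 ≤ n → μ ({ω | {ω | 1 ≤ N ω}.indicator X ω ≤ t} ∩ N ⁻¹' {n}) =
      μ {ω | X ω ≤ t} * μ (N ⁻¹' {n}) := fun t n hn => by
    refine Eq.trans (congrArg μ ?_)
      (hXN.measure_inter_preimage_eq_mul _ _ (measurableSet_Iic (a := t))
        (measurableSet_singleton n))
    ext ω
    refine and_congr_left fun h => ?_
    have h' : N ω = n := h
    show {ω | 1 ≤ N ω}.indicator X ω ≤ t ↔ X ω ≤ t
    rw [Set.indicator_of_mem (show ω ∈ {ω | 1 ≤ N ω} from (by omega : 1 ≤ N ω))]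
  have hfib : ∀ t : ℝ, ∀ n, μ ({ω | (∑ i ∈ Finset.range (N ω), W i ω * Xs i ω) /
      (∑ i ∈ Finset.range (N ω), W i ω) ≤ t} ∩ N ⁻¹' {n}) ≤
      μ ({ω | {ω | 1 ≤ N ω}.indicator X ω ≤ t} ∩ N ⁻¹' {n}) := by
    intro t n
    rcases Nat.eq_zero_or_pos n with rfl | hn
    -- When `N = 0` the quotient is `0 / 0 = 0`, matching the indicator.
    · refine measure_mono fun ω hω => ⟨?_, hω.2⟩
      have h0 : N ω = 0 := hω.2
      have h1 : (∑ i ∈ Finset.range (N ω), W i ω * Xs i ω) /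
        (∑ i ∈ Finset.range (N ω), W i ω) ≤ t := hω.1
      show {ω | 1 ≤ N ω}.indicator X ω ≤ t
      rw [Set.indicator_of_notMem (show ω ∉ {ω | 1 ≤ N ω} from (by omega : ¬ 1 ≤ N ω))]
      simpa [h0] using h1
    · rw [hQfib t n hn, hIfib t n hn]
      gcongr ?_ * _
      exact hDle t n hn
  refine ⟨fun t => ?_, fun x => ?_, fun hN2 t ht => ?_⟩
  · rw [measure_eq_tsum_inter_fiber μ hN (hQ t), measure_eq_tsum_inter_fiber μ hN (hI t)]
    exact ENNReal.tsum_le_tsum (hfib t)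
  · rw [measure_eq_tsum_inter_fiber μ hN (measurableSet_le (hsumm (V := fun n ω =>
        ∑ i ∈ Finset.range n, W i ω * Xs i ω) fun n => by fun_prop) measurable_const),
      measure_eq_tsum_inter_fiber μ hN (measurableSet_le (hsumm (V := fun n ω =>
        ∑ i ∈ Finset.range n, W i ω * X ω) fun n => by fun_prop) measurable_const)]
    refine ENNReal.tsum_le_tsum fun n => ?_
    have hS₁ : MeasurableSet {p : (ℕ → ℝ) × (ℕ → ℝ) |
        ∑ i ∈ Finset.range n, p.2 i * p.1 i ≤ x} :=
      measurableSet_le (by fun_prop) measurable_const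
    have hS₂ : MeasurableSet {p : ℝ × (ℕ → ℝ) | ∑ i ∈ Finset.range n, p.2 i * p.1 ≤ x} :=
      measurableSet_le (by fun_prop) measurable_const
    have h₁ : μ ({ω | ∑ i ∈ Finset.range (N ω), W i ω * Xs i ω ≤ x} ∩ N ⁻¹' {n}) =
        μ {ω | ∑ i ∈ Finset.range n, W i ω * Xs i ω ≤ x} * μ (N ⁻¹' {n}) := by
      refine Eq.trans (congrArg μ ?_)
        (hXsWN.measure_inter_preimage_eq_mul _ _ hS₁ (measurableSet_singleton n))
      ext ω
      refine and_congr_left fun h => ?_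
      have h' : N ω = n := h
      show ∑ i ∈ Finset.range (N ω), W i ω * Xs i ω ≤ x ↔ _
      rw [h']
      rfl
    have h₂ : μ ({ω | ∑ i ∈ Finset.range (N ω), W i ω * X ω ≤ x} ∩ N ⁻¹' {n}) =
        μ {ω | ∑ i ∈ Finset.range n, W i ω * X ω ≤ x} * μ (N ⁻¹' {n}) := by
      refine Eq.trans (congrArg μ ?_)
        (hXWN.measure_inter_preimage_eq_mul _ _ hS₂ (measurableSet_singleton n))
      ext ω
      refine and_congr_left fun h => ?_
      have h' : N ω = n := h
      show ∑ i ∈ Finset.range (N ω), W i ω * X ω ≤ x ↔ _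
      rw [h']
      rfl
    rw [h₁, h₂]
    gcongr ?_ * _
    rcases Nat.eq_zero_or_pos n with rfl | hn
    · simp
    · exact hElt x n hn
  · have hzX : ∀ᵐ ω ∂μ, z ≤ X ω := hid.symm.ae_snd (p := fun x => z ≤ x) measurableSet_Ici hz
    have hzt : z < t := (le_essInf_of_ae_le_real hzX).trans_lt ht
    -- One value `n ≥ 2` of positive mass suffices: its term in the series is strictly smaller, and
    -- the others are no larger.
    obtain ⟨n, hn, hn0⟩ : ∃ n, 2 ≤ n ∧ μ (N ⁻¹' {n}) ≠ 0 := by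
      by_contra! hcon
      refine hN2.ne' (measure_mono_null (t := ⋃ n, ⋃ _ : 2 ≤ n, N ⁻¹' {n}) ?_ ?_)
      · intro ω hω
        exact Set.mem_iUnion₂.2 ⟨N ω, hω, rfl⟩
      · exact measure_iUnion_null fun n => measure_iUnion_null fun hn => hcon n hn
    have hfin := measure_ne_top μ {ω | (∑ i ∈ Finset.range (N ω), W i ω * Xs i ω) /
      (∑ i ∈ Finset.range (N ω), W i ω) ≤ t}
    rw [measure_eq_tsum_inter_fiber μ hN (hQ t)] at hfin ⊢
    rw [measure_eq_tsum_inter_fiber μ hN (hI t)]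
    refine ENNReal.tsum_lt_tsum (i := n) hfin (hfib t) ?_
    rw [hQfib t n (by omega), hIfib t n (by omega)]
    exact ENNReal.mul_lt_mul_left hn0 (measure_ne_top _ _) (hDlt t hzt n hn)
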